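/- Let $\mathbb{K}$ be $\mathbb{R}$ or $\mathbb{C}$, and let $X$ be a compact metric space with metric $d$ and a distinguished base point $0\in X$. Let $\mathrm{Lip}_0(X)$ be the Banach space of all Lipschitz functions $f\colon X\to\mathbb{K}$ with $f(0)=0$, with the norm $$\mathrm{Lip}_d(f)=\sup\left\{\frac{|f(x)-f(y)|}{d(x,y)}\colon x,y\in X,\ x\neq y\right\},$$ and let $\mathrm{lip}_0(X)$ be its subspace of all $f$ that are supercontractive, i.e. for every $\varepsilon>0$ there is $\delta>0$ such that $|f(x)-f(y)|/d(x,y)<\varepsilon$ whenever $x,y\in X$ and $0<d(x,y)<\delta$. Suppose that $\mathrm{lip}_0(X)$ separates points uniformly, i.e. there is a constant $a>1$ such that for all $x,y\in X$ there is $f\in\mathrm{lip}_0(X)$ with $\mathrm{Lip}_d(f)\le a$ and $|f(x)-f(y)|=d(x,y)$. Let $\phi\colon X\to X$ be a Lipschitz map with $\phi(0)=0$, and let $C_\phi\colon\mathrm{Lip}_0(X)\to\mathrm{Lip}_0(X)$, $C_\phi(f)=f\circ\phi$, be the composition operator with symbol $\phi$. If $C_\phi$ is weakly compact (the image of the closed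 unit ball is relatively compact in the weak topology of $\mathrm{Lip}_0(X)$), then $C_\phi$ is compact. -/

import Mathlib

open Topology

/-- A map between metric spaces is supercontractive if `d(f x, f y) / d(x, y) → 0` as
`d(x, y) → 0`. -/
def IsSupercontractive {X Y : Type*} [MetricSpace X] [MetricSpace Y] (f : X → Y) : Prop :=
  ∀ ε > (0 : ℝ), ∃ δ > (0 : ℝ), ∀ x y : X,
    0 < dist x y → dist x y < δ → dist (f x) (f y) / dist x y < ε

/-- The vector space of all Lipschitz functions `X → 𝕜` vanishing at the base point `x₀`. -/
def lipZeroSubmodule (𝕜 : Type*) [RCLike 𝕜] (X : Type*) [MetricSpace X] (x₀ : X) :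
    Submodule 𝕜 (X → 𝕜) where
  carrier := {f | (∃ K, LipschitzWith K f) ∧ f x₀ = 0}
  add_mem' := by
    rintro f g ⟨⟨K, hf⟩, hf0⟩ ⟨⟨L, hg⟩, hg0⟩
    exact ⟨⟨K + L, hf.add hg⟩, by simp [hf0, hg0]⟩
  zero_mem' := ⟨⟨0, LipschitzWith.const 0⟩, rfl⟩
  smul_mem' := by
    rintro c f ⟨⟨K, hf⟩, hf0⟩
    refine ⟨⟨‖c‖₊ * K, ?_⟩, by simp [hf0]⟩
    refine LipschitzWith.of_dist_le_mul fun x y => ?_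
    have h := hf.dist_le_mul x y
    rw [dist_eq_norm] at h
    rw [Pi.smul_apply, Pi.smul_apply, dist_eq_norm, ← smul_sub, norm_smul, NNReal.coe_mul,
      coe_nnnorm, mul_assoc]
    exact mul_le_mul_of_nonneg_left h (norm_nonneg c)

/-- The space `Lip₀(X)` of the pointed metric space `(X, x₀)`. It is a separate type, so that its
norm and topology are those defined below (and not the topology of pointwise convergence). -/
def LipZero (𝕜 : Type*) [RCLike 𝕜] (X : Type*) [MetricSpace X] (x₀ : X) : Type _ :=
  lipZeroSubmodule 𝕜 X x₀

namespace LipZero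

variable {𝕜 : Type*} [RCLike 𝕜] {X : Type*} [MetricSpace X] {x₀ : X}

instance : AddCommGroup (LipZero 𝕜 X x₀) := inferInstanceAs (AddCommGroup (lipZeroSubmodule 𝕜 X x₀))

instance : Module 𝕜 (LipZero 𝕜 X x₀) := inferInstanceAs (Module 𝕜 (lipZeroSubmodule 𝕜 X x₀))

instance : FunLike (LipZero 𝕜 X x₀) X 𝕜 where
  coe f := f.1
  coe_injective _ _ h := Subtype.ext h

theorem zero_apply (x : X) : (0 : LipZero 𝕜 X x₀) x = 0 := rfl

theorem add_apply (f g : LipZero 𝕜 X x₀) (x : X) : (f + g) x = f x + g x := rfl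

theorem smul_apply (c : 𝕜) (f : LipZero 𝕜 X x₀) (x : X) : (c • f) x = c • f x := rfl

theorem exists_lipschitzWith (f : LipZero 𝕜 X x₀) : ∃ K, LipschitzWith K f := f.2.1

theorem map_base (f : LipZero 𝕜 X x₀) : f x₀ = 0 := f.2.2

/-- The Lipschitz norm: the supremum of `|f x - f y| / d(x, y)` over all pairs `x ≠ y`. -/
noncomputable instance : Norm (LipZero 𝕜 X x₀) where
  norm f := ⨆ p : {p : X × X // p.1 ≠ p.2}, ‖f p.1.1 - f p.1.2‖ / dist p.1.1 p.1.2

theorem norm_def (f : LipZero 𝕜 X x₀) :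
    ‖f‖ = ⨆ p : {p : X × X // p.1 ≠ p.2}, ‖f p.1.1 - f p.1.2‖ / dist p.1.1 p.1.2 := rfl

theorem norm_nonneg' (f : LipZero 𝕜 X x₀) : 0 ≤ ‖f‖ :=
  Real.iSup_nonneg fun _ => by positivity

theorem norm_sub_le (f : LipZero 𝕜 X x₀) (x y : X) : ‖f x - f y‖ ≤ ‖f‖ * dist x y := by
  obtain ⟨K, hK⟩ := f.exists_lipschitzWith
  rcases eq_or_ne x y with rfl | hxy
  · simp
  · rw [← div_le_iff₀ (dist_pos.2 hxy), norm_def]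
    refine le_ciSup (f := fun p : {p : X × X // p.1 ≠ p.2} =>
      ‖f p.1.1 - f p.1.2‖ / dist p.1.1 p.1.2) ⟨K, ?_⟩ ⟨(x, y), hxy⟩
    rintro _ ⟨p, rfl⟩
    refine (div_le_iff₀ (dist_pos.2 p.2)).2 ?_
    rw [← dist_eq_norm]
    exact hK.dist_le_mul _ _

theorem norm_le_of_forall (f : LipZero 𝕜 X x₀) {C : ℝ} (hC : 0 ≤ C)
    (h : ∀ x y, ‖f x - f y‖ ≤ C * dist x y) : ‖f‖ ≤ C :=
  Real.iSup_le (fun p => (div_le_iff₀ (dist_pos.2 p.2)).2 (h _ _)) hC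

theorem normedSpaceCore : NormedSpace.Core 𝕜 (LipZero 𝕜 X x₀) where
  norm_nonneg := norm_nonneg'
  norm_smul c f := by
    rw [norm_def, norm_def, Real.mul_iSup_of_nonneg (norm_nonneg c)]
    congr 1
    funext p
    rw [smul_apply, smul_apply, ← smul_sub, norm_smul, mul_div_assoc]
  norm_triangle f g := by
    refine norm_le_of_forall _ (add_nonneg (norm_nonneg' f) (norm_nonneg' g)) fun x y => ?_
    rw [add_apply, add_apply, add_sub_add_comm, add_mul]
    exact (norm_add_le _ _).trans (add_le_add (norm_sub_le f x y) (norm_sub_le g x y))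
  norm_eq_zero_iff f := by
    constructor
    · intro h
      refine DFunLike.ext _ _ fun x => ?_
      have hx := norm_sub_le f x x₀
      rw [h, zero_mul, map_base, sub_zero] at hx
      exact norm_le_zero_iff.1 hx
    · rintro rfl
      exact le_antisymm (norm_le_of_forall _ le_rfl fun x y => by simp [zero_apply])
        (norm_nonneg' _)

noncomputable instance : NormedAddCommGroup (LipZero 𝕜 X x₀) :=
  NormedAddCommGroup.ofCore normedSpaceCore

noncomputable instance : NormedSpace 𝕜 (LipZero 𝕜 X x₀) :=
  NormedSpace.ofCore normedSpaceCore

/-- The composition operator `f ↦ f ∘ φ` on `Lip₀(X)`, for a base point-preserving Lipschitz map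
`φ : X → X`. -/
noncomputable def compositionOperator (𝕜 : Type*) [RCLike 𝕜] {X : Type*} [MetricSpace X] {x₀ : X}
    (φ : X → X) (hφ : ∃ K, LipschitzWith K φ) (hφ₀ : φ x₀ = x₀) :
    LipZero 𝕜 X x₀ →L[𝕜] LipZero 𝕜 X x₀ :=
  LinearMap.mkContinuousOfExistsBound
    { toFun := fun f => ⟨f ∘ φ, by
        obtain ⟨K, hK⟩ := hφ
        obtain ⟨L, hL⟩ := f.exists_lipschitzWith
        exact ⟨⟨L * K, hL.comp hK⟩, by rw [Function.comp_apply, hφ₀, map_base]⟩⟩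
      map_add' := fun _ _ => rfl
      map_smul' := fun _ _ => rfl } (by
    obtain ⟨K, hK⟩ := hφ
    refine ⟨K, fun f => norm_le_of_forall _ (by positivity) fun x y => ?_⟩
    calc ‖f (φ x) - f (φ y)‖ ≤ ‖f‖ * dist (φ x) (φ y) := norm_sub_le f _ _
      _ ≤ ‖f‖ * (K * dist x y) :=
        mul_le_mul_of_nonneg_left (hK.dist_le_mul x y) (norm_nonneg f)
      _ = K * ‖f‖ * dist x y := by ring)

theorem compositionOperator_apply (φ : X → X) (hφ : ∃ K, LipschitzWith K φ) (hφ₀ : φ x₀ = x₀)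
    (f : LipZero 𝕜 X x₀) (x : X) : compositionOperator 𝕜 φ hφ hφ₀ f x = f (φ x) := rfl

end LipZero

/-- The little Lipschitz space `lip₀(X)`: the subspace of `Lip₀(X)` formed by the supercontractive
functions. -/
def littleLipZero (𝕜 : Type*) [RCLike 𝕜] (X : Type*) [MetricSpace X] (x₀ : X) :
    Submodule 𝕜 (LipZero 𝕜 X x₀) where
  carrier := {f | IsSupercontractive f}
  add_mem' := by
    intro f g hf hg ε hε
    obtain ⟨δ, hδ, h⟩ := hf (ε / 2) (half_pos hε)
    obtain ⟨η, hη, h'⟩ := hg (ε / 2) (half_pos hε)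
    refine ⟨min δ η, lt_min hδ hη, fun x y hxy hlt => ?_⟩
    have h1 := h x y hxy (hlt.trans_le (min_le_left _ _))
    have h2 := h' x y hxy (hlt.trans_le (min_le_right _ _))
    calc dist ((f + g) x) ((f + g) y) / dist x y
        ≤ (dist (f x) (f y) + dist (g x) (g y)) / dist x y :=
          div_le_div_of_nonneg_right (dist_add_add_le _ _ _ _) hxy.le
      _ = dist (f x) (f y) / dist x y + dist (g x) (g y) / dist x y := add_div _ _ _
      _ < ε := by linarith
  zero_mem' := fun ε hε => ⟨1, one_pos, fun x y _ _ => by simpa [LipZero.zero_apply] using hε⟩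
  smul_mem' := by
    intro c f hf ε hε
    have hc : 0 < ‖c‖ + 1 := by positivity
    obtain ⟨δ, hδ, h⟩ := hf (ε / (‖c‖ + 1)) (div_pos hε hc)
    refine ⟨δ, hδ, fun x y hxy hlt => ?_⟩
    have h1 := (lt_div_iff₀ hc).1 (h x y hxy hlt)
    have h2 : 0 ≤ dist (f x) (f y) / dist x y := by positivity
    rw [LipZero.smul_apply, LipZero.smul_apply, dist_smul₀, mul_div_assoc]
    nlinarith

/-- `lip₀(X)` separates points uniformly: there is a constant `a > 1` such that for all `x, y` some
`f ∈ lip₀(X)` of Lipschitz norm at most `a` satisfies `|f x - f y| = d(x, y)`. -/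
def LipSeparatesPointsUniformly (𝕜 : Type*) [RCLike 𝕜] (X : Type*) [MetricSpace X] (x₀ : X) :
    Prop :=
  ∃ a : ℝ, 1 < a ∧ ∀ x y : X, ∃ f ∈ littleLipZero 𝕜 X x₀, ‖f‖ ≤ a ∧ ‖f x - f y‖ = dist x y

/-- A bounded operator is weakly compact if the image of the closed unit ball is relatively compact
in the weak topology. -/
def IsWeaklyCompactOperator {𝕜 E F : Type*} [RCLike 𝕜] [NormedAddCommGroup E] [NormedSpace 𝕜 E]
    [NormedAddCommGroup F] [NormedSpace 𝕜 F] (T : E →L[𝕜] F) : Prop :=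
  IsCompact (closure (toWeakSpace 𝕜 F '' (T '' Metric.closedBall 0 1)))

/-!
The key point is that a weakly compact `C_φ` forces `φ` itself to be supercontractive; once this is
known, compactness follows from Arzelà–Ascoli, because on the unit ball of `Lip₀(X)` the map
`f ↦ f ∘ φ` is continuous from the uniform norm to the Lipschitz norm
(`isCompactOperator_compositionOperator`).

Suppose that `φ` is not supercontractive. Then there are pairs `x k ≠ y k` with
`dist (φ (x k)) (φ (y k)) ≥ ε * dist (x k) (y k)` and `r k = dist (φ (x k)) (φ (y k))` as small as
desired. Uniform separation, followed by truncation at height `r k`, gives functions `h k` in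
`lip₀(X)` of norm at most `a`, of oscillation at most `r k`, and with
`‖h k (φ (x k)) - h k (φ (y k))‖ = r k` (`exists_littleLipZero_bump`). Such a function is nearly
constant at scales well below its own modulus of supercontractivity and, by the bound on the
oscillation, at scales much larger than `r k`. If `r k` decreases fast enough, then at each scale
at most one of the `h k` is not nearly constant. Hence the partial sums of `∑ h k` are bounded in
`Lip₀(X)`, while their slope between `φ (x k)` and `φ (y k)` stays away from `0`
(`exists_gliding_hump`). Their images under `C_φ` lie in `lip₀(X)`, which is norm closed and convex,
hence weakly closed; so a weak cluster point of the images lies in `lip₀(X)`. But its slopes between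
`x k` and `y k` are bounded away from `0`, although `dist (x k) (y k) → 0`: a contradiction.
-/

/-! ### Supercontractive maps -/

/-- Supercontractivity without division, so that the case of equal points needs no separate care. -/
theorem isSupercontractive_iff {X Y : Type*} [MetricSpace X] [MetricSpace Y] {f : X → Y} :
    IsSupercontractive f ↔ ∀ ε > (0 : ℝ), ∃ δ > (0 : ℝ), ∀ x y : X,
      dist x y < δ → dist (f x) (f y) ≤ ε * dist x y := by
  constructor
  · intro h ε hε
    obtain ⟨δ, hδ, H⟩ := h ε hε
    refine ⟨δ, hδ, fun x y hxy => ?_⟩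
    rcases eq_or_ne x y with rfl | hne
    · simp
    · exact ((div_lt_iff₀ (dist_pos.2 hne)).1 (H x y (dist_pos.2 hne) hxy)).le
  · intro h ε hε
    obtain ⟨δ, hδ, H⟩ := h (ε / 2) (half_pos hε)
    refine ⟨δ, hδ, fun x y hpos hxy => ?_⟩
    rw [div_lt_iff₀ hpos]
    have := H x y hxy
    nlinarith

theorem IsSupercontractive.comp_lipschitzWith {X Y Z : Type*} [MetricSpace X] [MetricSpace Y]
    [MetricSpace Z] {f : Y → Z} {φ : X → Y} {K : NNReal} (hf : IsSupercontractive f)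
    (hφ : LipschitzWith K φ) : IsSupercontractive (f ∘ φ) := by
  rw [isSupercontractive_iff] at hf ⊢
  intro ε hε
  have hK : (0 : ℝ) < K + 1 := by positivity
  obtain ⟨δ, hδ, H⟩ := hf (ε / (K + 1)) (div_pos hε hK)
  have hle (x y : X) : dist (φ x) (φ y) ≤ (K + 1) * dist x y :=
    (hφ.dist_le_mul x y).trans (by nlinarith [dist_nonneg (x := x) (y := y)])
  refine ⟨δ / (K + 1), div_pos hδ hK, fun x y hxy => ?_⟩
  rw [lt_div_iff₀ hK] at hxy
  calc dist (f (φ x)) (f (φ y)) ≤ ε / (K + 1) * dist (φ x) (φ y) :=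
        H _ _ ((hle x y).trans_lt (by linarith))
    _ ≤ ε / (K + 1) * ((K + 1) * dist x y) := by gcongr; exact hle x y
    _ = ε * dist x y := by field_simp

/-- A map dominated by a supercontractive one is supercontractive. -/
theorem IsSupercontractive.of_dist_le {X Y Z : Type*} [MetricSpace X] [MetricSpace Y]
    [MetricSpace Z] {f : X → Y} {g : X → Z} (hf : IsSupercontractive f)
    (h : ∀ x y, dist (g x) (g y) ≤ dist (f x) (f y)) : IsSupercontractive g := by
  rw [isSupercontractive_iff] at hf ⊢
  intro ε hε
  obtain ⟨δ, hδ, H⟩ := hf ε hε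
  exact ⟨δ, hδ, fun x y hxy => (h x y).trans (H x y hxy)⟩

/-! ### The little Lipschitz space -/

section LittleLip

variable {𝕜 : Type*} [RCLike 𝕜] {X : Type*} [MetricSpace X] {x₀ : X}

theorem LipZero.sub_apply (f g : LipZero 𝕜 X x₀) (x : X) : (f - g) x = f x - g x := rfl

theorem LipZero.sum_apply {ι : Type*} (s : Finset ι) (f : ι → LipZero 𝕜 X x₀) (x : X) :
    (∑ i ∈ s, f i) x = ∑ i ∈ s, f i x :=
  map_sum (⟨⟨fun f : LipZero 𝕜 X x₀ => f x, rfl⟩, fun _ _ => rfl⟩ : LipZero 𝕜 X x₀ →+ 𝕜) f s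

/-- Evaluation at `x` minus evaluation at `y`, as a continuous functional on `Lip₀(X)`. -/
noncomputable def LipZero.evalSub (x y : X) : LipZero 𝕜 X x₀ →L[𝕜] 𝕜 :=
  LinearMap.mkContinuous
    { toFun := fun f => f x - f y
      map_add' := fun f g => add_sub_add_comm (f x) (g x) (f y) (g y)
      map_smul' := fun c f => (smul_sub c (f x) (f y)).symm }
    (dist x y) fun f => (LipZero.norm_sub_le f x y).trans_eq (mul_comm _ _)

theorem isClosed_littleLipZero : IsClosed (littleLipZero 𝕜 X x₀ : Set (LipZero 𝕜 X x₀)) := by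
  refine isClosed_of_closure_subset fun f hf => ?_
  refine isSupercontractive_iff.2 fun ε hε => ?_
  obtain ⟨g, hg, hfg⟩ := Metric.mem_closure_iff.1 hf (ε / 2) (half_pos hε)
  obtain ⟨δ, hδ, H⟩ := isSupercontractive_iff.1 hg (ε / 2) (half_pos hε)
  refine ⟨δ, hδ, fun x y hxy => ?_⟩
  have h1 := H x y hxy
  have h2 := LipZero.norm_sub_le (f - g) x y
  rw [dist_eq_norm] at h1 hfg ⊢
  rw [LipZero.sub_apply, LipZero.sub_apply] at h2
  calc ‖f x - f y‖ = ‖(f x - g x - (f y - g y)) + (g x - g y)‖ := by congr 1; ring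
    _ ≤ ‖f - g‖ * dist x y + ε / 2 * dist x y := (norm_add_le _ _).trans (add_le_add h2 h1)
    _ ≤ ε / 2 * dist x y + ε / 2 * dist x y := by gcongr
    _ = ε * dist x y := by ring

/-- Truncating a function that separates `u` and `v` at height `dist u v` makes its oscillation as
small as its values at `u` and `v` permit. -/
theorem exists_littleLipZero_bump {a : ℝ} {u v : X} {g : LipZero 𝕜 X x₀}
    (hg : g ∈ littleLipZero 𝕜 X x₀) (hga : ‖g‖ ≤ a) (hguv : ‖g u - g v‖ = dist u v) :
    ∃ h ∈ littleLipZero 𝕜 X x₀, (∀ s t, ‖h s - h t‖ ≤ a * dist s t) ∧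
      (∀ s t, ‖h s - h t‖ ≤ dist u v) ∧ ‖h u - h v‖ = dist u v := by
  let b : X → ℝ := fun x => min ‖g x - g u‖ (dist u v)
  have hb0 (x : X) : 0 ≤ b x := le_min (norm_nonneg _) dist_nonneg
  have hb1 (x : X) : b x ≤ dist u v := min_le_right _ _
  have hbg (s t : X) : |b s - b t| ≤ ‖g s - g t‖ := by
    refine (abs_min_sub_min_le_max _ _ _ _).trans ?_
    rw [sub_self, abs_zero, max_eq_left (abs_nonneg _)]
    refine (abs_norm_sub_norm_le _ _).trans (le_of_eq ?_)
    congr 1; ring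
  let w : X → 𝕜 := fun x => ((b x - b x₀ : ℝ) : 𝕜)
  have hw (s t : X) : ‖w s - w t‖ = |b s - b t| := by
    simp only [w]
    rw [← RCLike.ofReal_sub, RCLike.norm_ofReal]
    congr 1; ring
  have hwg (s t : X) : dist (w s) (w t) ≤ dist (g s) (g t) := by
    rw [dist_eq_norm, dist_eq_norm, hw]; exact hbg s t
  obtain ⟨K, hK⟩ := g.exists_lipschitzWith
  refine ⟨⟨w, ⟨K, LipschitzWith.of_dist_le_mul fun s t =>
    (hwg s t).trans (hK.dist_le_mul s t)⟩, by simp [w]⟩,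
    IsSupercontractive.of_dist_le hg hwg, fun s t => ?_, fun s t => ?_, ?_⟩
  · refine ((hw s t).trans_le (hbg s t)).trans ((LipZero.norm_sub_le g s t).trans ?_)
    gcongr
  · refine (hw s t).trans_le (abs_sub_le_iff.2 ⟨?_, ?_⟩) <;> linarith [hb0 s, hb0 t, hb1 s, hb1 t]
  · refine (hw u v).trans ?_
    have h1 : b u = 0 := by simp [b]
    have h2 : b v = dist u v := by simp only [b]; rw [norm_sub_rev, hguv, min_self]
    rw [h1, h2, zero_sub, abs_neg, abs_of_nonneg dist_nonneg]

/-! ### The gliding hump -/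

/-- To be read with `z k` the increment of the `k`-th hump between two points at distance `d`: if
all the increments are at most `a * d`, and all but at most one are at most `c k * d`, then a single
term `a * d` accounts for the exceptional hump. -/
theorem sum_le_of_subsingleton {N : ℕ} {z c : ℕ → ℝ} {a d : ℝ} (had : 0 ≤ a * d)
    (hcd : ∀ k, 0 ≤ c k * d) (hza : ∀ k, z k ≤ a * d)
    (hs : ∀ j k, c j * d < z j → c k * d < z k → j = k) :
    ∑ k ∈ Finset.range N, z k ≤ (∑ k ∈ Finset.range N, c k) * d + a * d := by
  classical
  have h1 : ∀ k ∈ Finset.range N, z k ≤ c k * d + if c k * d < z k then a * d else 0 := by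
    intro k _
    split_ifs with h
    · linarith [hcd k, hza k]
    · linarith
  refine (Finset.sum_le_sum h1).trans ?_
  rw [Finset.sum_add_distrib, ← Finset.sum_mul, ← Finset.sum_filter, Finset.sum_const,
    nsmul_eq_mul]
  have h2 : ((Finset.range N).filter fun k => c k * d < z k).card ≤ 1 :=
    Finset.card_le_one.2 fun j hj k hk =>
      hs j k (Finset.mem_filter.1 hj).2 (Finset.mem_filter.1 hk).2
  have h3 : ((((Finset.range N).filter fun k => c k * d < z k).card : ℕ) : ℝ) ≤ 1 := by
    exact_mod_cast h2
  nlinarith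

theorem sum_range_half_pow_div_four_le (N : ℕ) :
    ∑ k ∈ Finset.range N, (1 / 2 : ℝ) ^ k / 4 ≤ 1 / 2 := by
  have h : ∑ k ∈ Finset.range N, (1 / 2 : ℝ) ^ k ≤ 2 := by
    have := geom_sum_eq (x := (1 / 2 : ℝ)) (by norm_num) N
    rw [this, div_le_iff_of_neg (by norm_num)]
    have : (0 : ℝ) ≤ (1 / 2) ^ N := by positivity
    linarith
  rw [← Finset.sum_div]
  linarith

/-- Pairs `u, v` from a set `P` containing pairs of distinct points at arbitrarily small distance
carry a bounded sequence in `lip₀(X)`, whose slopes at suitable pairs `u k, v k` of `P` with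
`dist (u k) (v k) → 0` are eventually at least `1 / 2`. -/
theorem exists_gliding_hump (hsep : LipSeparatesPointsUniformly 𝕜 X x₀) {P : X → X → Prop}
    (hP : ∀ ρ > (0 : ℝ), ∃ u v, P u v ∧ u ≠ v ∧ dist u v < ρ) :
    ∃ (C : ℝ) (S : ℕ → LipZero 𝕜 X x₀), (∀ N, S N ∈ littleLipZero 𝕜 X x₀) ∧ (∀ N, ‖S N‖ ≤ C) ∧
      ∀ η > (0 : ℝ), ∃ u v, P u v ∧ u ≠ v ∧ dist u v < η ∧
        ∀ᶠ N in Filter.atTop, dist u v / 2 ≤ ‖S N u - S N v‖ := by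
  obtain ⟨a, ha, hsep⟩ := hsep
  have : Nonempty X := ⟨x₀⟩
  choose! u v hPuv hne hρ using hP
  choose g hg hga hguv using hsep
  choose h hh hha hosc huv using fun s t =>
    exists_littleLipZero_bump (hg s t) (hga s t) (hguv s t)
  -- The slopes of the humps outside their critical scale; their sum is below `1 / 2`.
  let c : ℕ → ℝ := fun k => (1 / 2) ^ k / 4
  have hc0 (k : ℕ) : 0 < c k := by positivity
  have hc1 (k : ℕ) : c k ≤ 1 / 4 := by
    have : (1 / 2 : ℝ) ^ k ≤ 1 := pow_le_one₀ (by norm_num) (by norm_num)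
    simp only [c]; linarith
  -- The scale `D k s t` below which the hump at `(s, t)` has slope at most `c k`.
  choose D hD0 hD using fun k s t => isSupercontractive_iff.1 (hh s t) (c k) (hc0 k)
  let δ : ℕ → ℝ → ℝ := fun k ρ => min ρ (D k (u ρ) (v ρ))
  -- The next hump is chosen so small that, at scales above `δ k`, it has slope at most `c (k + 1)`.
  let ρ : ℕ → ℝ := fun k => Nat.rec 1 (fun k r => c (k + 1) * δ k r) k
  have hρs (k : ℕ) : ρ (k + 1) = c (k + 1) * δ k (ρ k) := rfl
  have hρ0 (k : ℕ) : 0 < ρ k := by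
    induction k with
    | zero => exact one_pos
    | succ k ih => exact mul_pos (hc0 _) (lt_min ih (hD0 _ _ _))
  have hδ0 (k : ℕ) : 0 < δ k (ρ k) := lt_min (hρ0 k) (hD0 _ _ _)
  have hδρ (k : ℕ) : δ k (ρ k) ≤ ρ k := min_le_left _ _
  have hδanti : Antitone fun k => δ k (ρ k) := antitone_nat_of_succ_le fun k => by
    refine (hδρ (k + 1)).trans ?_
    rw [hρs]
    nlinarith [hc1 (k + 1), hδ0 k]
  have hρc (k : ℕ) : ρ k ≤ (1 / 4) ^ k := by
    induction k with
    | zero => exact le_of_eq rfl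
    | succ k ih =>
      rw [hρs, pow_succ']
      exact mul_le_mul (hc1 _) ((hδρ k).trans ih) (hδ0 k).le (by norm_num)
  let U : ℕ → X := fun k => u (ρ k)
  let V : ℕ → X := fun k => v (ρ k)
  let H : ℕ → LipZero 𝕜 X x₀ := fun k => h (U k) (V k)
  have hUV (k : ℕ) : dist (U k) (V k) < ρ k := hρ _ (hρ0 k)
  have hpos (k : ℕ) : 0 < dist (U k) (V k) := dist_pos.2 (hne _ (hρ0 k))
  have hlow (k : ℕ) (s t : X) (hlt : c k * dist s t < ‖H k s - H k t‖) :
      δ k (ρ k) ≤ dist s t := by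
    by_contra! hcon
    have := hD k (U k) (V k) s t (hcon.trans_le (min_le_right _ _))
    rw [dist_eq_norm] at this
    exact absurd hlt this.not_gt
  have hlt_aux (s t : X) (j k : ℕ) (hj : c j * dist s t < ‖H j s - H j t‖)
      (hk : c k * dist s t < ‖H k s - H k t‖) : ¬ j < k := by
    intro hjk
    obtain ⟨m, rfl⟩ := Nat.exists_eq_add_of_lt hjk
    have h1 : δ (j + m) (ρ (j + m)) ≤ dist s t :=
      (hδanti (Nat.le_add_right j m)).trans (hlow j s t hj)
    have h2 : ‖H (j + m + 1) s - H (j + m + 1) t‖ ≤ c (j + m + 1) * dist s t :=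
      ((hosc _ _ s t).trans (hUV (j + m + 1)).le).trans
        ((hρs (j + m)).trans_le (mul_le_mul_of_nonneg_left h1 (hc0 _).le))
    exact absurd hk h2.not_gt
  have hsub (s t : X) (j k : ℕ) (hj : c j * dist s t < ‖H j s - H j t‖)
      (hk : c k * dist s t < ‖H k s - H k t‖) : j = k :=
    le_antisymm (not_lt.1 (hlt_aux s t k j hk hj)) (not_lt.1 (hlt_aux s t j k hj hk))
  have hdiff (s t : X) (I : Finset ℕ) :
      (∑ k ∈ I, H k) s - (∑ k ∈ I, H k) t = ∑ k ∈ I, (H k s - H k t) := by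
    rw [LipZero.sum_apply, LipZero.sum_apply, Finset.sum_sub_distrib]
  refine ⟨1 / 2 + a, fun N => ∑ k ∈ Finset.range N, H k,
    fun N => Submodule.sum_mem _ fun k _ => hh _ _, fun N => ?_, fun η hη => ?_⟩
  · refine LipZero.norm_le_of_forall _ (by linarith) fun s t => ?_
    rw [hdiff]
    refine (norm_sum_le _ _).trans ((sum_le_of_subsingleton (c := c) (a := a) (d := dist s t)
      (by positivity) (fun k => mul_nonneg (hc0 k).le dist_nonneg) (fun k => hha _ _ s t)
      (hsub s t)).trans ?_)
    have := sum_range_half_pow_div_four_le N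
    rw [add_mul]
    gcongr
  · obtain ⟨k, hk⟩ := exists_pow_lt_of_lt_one hη (show (1 / 4 : ℝ) < 1 by norm_num)
    refine ⟨U k, V k, hPuv _ (hρ0 k), hne _ (hρ0 k), (hUV k).trans ((hρc k).trans_lt hk), ?_⟩
    filter_upwards [Filter.eventually_gt_atTop k] with N hN
    have hkk : ‖H k (U k) - H k (V k)‖ = dist (U k) (V k) := huv _ _
    have hexc : c k * dist (U k) (V k) < ‖H k (U k) - H k (V k)‖ := by
      rw [hkk]; nlinarith [hc1 k, hpos k]
    rw [hdiff, ← Finset.add_sum_erase _ _ (Finset.mem_range.2 hN)]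
    have hrest : ‖∑ j ∈ (Finset.range N).erase k, (H j (U k) - H j (V k))‖
        ≤ dist (U k) (V k) / 2 := by
      calc ‖∑ j ∈ (Finset.range N).erase k, (H j (U k) - H j (V k))‖
          ≤ ∑ j ∈ (Finset.range N).erase k, c j * dist (U k) (V k) :=
            norm_sum_le_of_le _ fun j hj => not_lt.1 fun hlt =>
              (Finset.mem_erase.1 hj).1 (hsub _ _ _ _ hlt hexc)
        _ ≤ ∑ j ∈ Finset.range N, c j * dist (U k) (V k) :=
            Finset.sum_le_sum_of_subset_of_nonneg (Finset.erase_subset _ _)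
              fun j _ _ => mul_nonneg (hc0 j).le dist_nonneg
        _ ≤ 1 / 2 * dist (U k) (V k) := by
            rw [← Finset.sum_mul]
            exact mul_le_mul_of_nonneg_right (sum_range_half_pow_div_four_le N) dist_nonneg
        _ = dist (U k) (V k) / 2 := by ring
    have := norm_sub_le_norm_add (H k (U k) - H k (V k))
      (∑ j ∈ (Finset.range N).erase k, (H j (U k) - H j (V k)))
    linarith

/-! ### Weak compactness forces supercontractivity -/

theorem isClosed_toWeakSpace_image {E : Type*} [NormedAddCommGroup E] [NormedSpace 𝕜 E]
    {p : Submodule 𝕜 E} (hp : IsClosed (p : Set E)) :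
    IsClosed (toWeakSpace 𝕜 E '' (p : Set E)) := by
  let : NormedSpace ℝ E := NormedSpace.restrictScalars ℝ 𝕜 E
  have : IsScalarTower ℝ 𝕜 E := RestrictScalars.isScalarTower ℝ 𝕜 E
  have hconv : Convex ℝ (p : Set E) := (p.restrictScalars ℝ).convex
  have h := hconv.toWeakSpace_closure 𝕜
  rw [hp.closure_eq] at h
  exact closure_eq_iff_isClosed.1 h.symm

/-- The images of a bounded sequence under a weakly compact operator have a weak cluster point. -/
theorem IsWeaklyCompactOperator.exists_mapClusterPt {E F : Type*} [NormedAddCommGroup E]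
    [NormedSpace 𝕜 E] [NormedAddCommGroup F] [NormedSpace 𝕜 F] {T : E →L[𝕜] F}
    (hT : IsWeaklyCompactOperator T) {S : ℕ → E} (hS : ∀ N, ‖S N‖ ≤ 1) :
    ∃ w : F, MapClusterPt (toWeakSpace 𝕜 F w) Filter.atTop fun N => toWeakSpace 𝕜 F (T (S N)) := by
  obtain ⟨w, -, hw⟩ := IsCompact.exists_mapClusterPt hT (f := Filter.atTop)
    (u := fun N => toWeakSpace 𝕜 F (T (S N))) <| Filter.le_principal_iff.2 <| Filter.mem_map.2 <|
      Filter.univ_mem' fun N => subset_closure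
        (Set.mem_image_of_mem _ (Set.mem_image_of_mem _ (mem_closedBall_zero_iff.2 (hS N))))
  exact ⟨(toWeakSpace 𝕜 F).symm w, by simpa using hw⟩

/-- A weak cluster point of the images of the gliding hump lies in `lip₀(X)`, as this subspace is
weakly closed and invariant under composition with `φ`, but it inherits the large slopes. -/
theorem isSupercontractive_of_isWeaklyCompactOperator
    (hsep : LipSeparatesPointsUniformly 𝕜 X x₀)
    (φ : X → X) (hφ : ∃ K, LipschitzWith K φ) (hφ₀ : φ x₀ = x₀)
    (hw : IsWeaklyCompactOperator
      (LipZero.compositionOperator 𝕜 φ hφ hφ₀ : LipZero 𝕜 X x₀ →L[𝕜] LipZero 𝕜 X x₀)) :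
    IsSupercontractive φ := by
  obtain ⟨K, hK⟩ := id hφ
  by_contra hcon
  rw [isSupercontractive_iff] at hcon
  push Not at hcon
  obtain ⟨ε, hε, hcon⟩ := hcon
  have hP : ∀ ρ > (0 : ℝ), ∃ u v, (∃ x y, φ x = u ∧ φ y = v ∧ ε * dist x y < dist u v) ∧
      u ≠ v ∧ dist u v < ρ := by
    intro ρ hρ
    have hK1 : (0 : ℝ) < K + 1 := by positivity
    obtain ⟨x, y, hxy, hlt⟩ := hcon (ρ / (K + 1)) (div_pos hρ hK1)
    refine ⟨φ x, φ y, ⟨x, y, rfl, rfl, hlt⟩, dist_pos.1 (lt_of_le_of_lt (by positivity) hlt), ?_⟩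
    rw [lt_div_iff₀ hK1] at hxy
    nlinarith [hK.dist_le_mul x y, dist_nonneg (x := x) (y := y)]
  obtain ⟨C, S, hSlip, hSC, hS⟩ := exists_gliding_hump hsep hP
  set T : LipZero 𝕜 X x₀ →L[𝕜] LipZero 𝕜 X x₀ := LipZero.compositionOperator 𝕜 φ hφ hφ₀ with hT
  have hC : 0 < |C| + 1 := by positivity
  let b : 𝕜 := (((|C| + 1)⁻¹ : ℝ) : 𝕜)
  have hb : ‖b‖ = (|C| + 1)⁻¹ := by
    simp only [b]
    rw [RCLike.norm_ofReal, abs_of_pos (inv_pos.2 hC)]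
  obtain ⟨w, hclus⟩ := hw.exists_mapClusterPt (S := fun N => b • S N) fun N => by
    rw [norm_smul, hb, inv_mul_le_iff₀ hC, mul_one]
    linarith [hSC N, le_abs_self C]
  have hwlip : w ∈ littleLipZero 𝕜 X x₀ := by
    have hmem : toWeakSpace 𝕜 _ w ∈ toWeakSpace 𝕜 (LipZero 𝕜 X x₀) ''
        (littleLipZero 𝕜 X x₀ : Set (LipZero 𝕜 X x₀)) := by
      refine (isClosed_toWeakSpace_image isClosed_littleLipZero).mem_of_mapClusterPt hclus
        (Filter.Eventually.of_forall fun N => Set.mem_image_of_mem _ ?_)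
      exact ((littleLipZero 𝕜 X x₀).smul_mem b (hSlip N)).comp_lipschitzWith hK
    exact (Set.InjOn.mem_image_iff (toWeakSpace 𝕜 _).injective.injOn (Set.subset_univ _)
      trivial).1 hmem
  -- The slopes of `w` at the pairs found below are at least `ε * (|C| + 1)⁻¹ / 2`; half of that
  -- gives the contradiction.
  obtain ⟨δ, hδ, hwδ⟩ := isSupercontractive_iff.1 hwlip (ε * (|C| + 1)⁻¹ / 4) (by positivity)
  obtain ⟨_, _, ⟨x, y, rfl, rfl, hxy⟩, hne, hlt, hev⟩ := hS (ε * δ) (mul_pos hε hδ)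
  have hdist : 0 < dist (φ x) (φ y) := dist_pos.2 hne
  have hwxy : (|C| + 1)⁻¹ * (dist (φ x) (φ y) / 2) ≤ ‖w x - w y‖ := by
    -- The functional `evalSub x y` is weakly continuous, so the bound passes to the cluster point.
    have hcont : Continuous fun z : WeakSpace 𝕜 (LipZero 𝕜 X x₀) =>
        ‖(LipZero.evalSub x y : LipZero 𝕜 X x₀ →L[𝕜] 𝕜) ((toWeakSpace 𝕜 _).symm z)‖ :=
      (WeakBilin.eval_continuous (topDualPairing 𝕜 (LipZero 𝕜 X x₀)).flip
        (LipZero.evalSub x y)).norm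
    refine (isClosed_le continuous_const hcont).mem_of_mapClusterPt hclus ?_
    filter_upwards [hev] with N hN
    have h : T (b • S N) x - T (b • S N) y = b * (S N (φ x) - S N (φ y)) :=
      (mul_sub b (S N (φ x)) (S N (φ y))).symm
    change _ ≤ ‖T (b • S N) x - T (b • S N) y‖
    rw [h, norm_mul, hb]
    gcongr
  have h1 := hwδ x y (lt_of_mul_lt_mul_left (hxy.trans hlt) hε.le)
  rw [dist_eq_norm] at h1
  have h2 : (|C| + 1)⁻¹ * (ε * dist x y) < (|C| + 1)⁻¹ * dist (φ x) (φ y) :=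
    mul_lt_mul_of_pos_left hxy (inv_pos.2 hC)
  have h3 : 0 < (|C| + 1)⁻¹ * dist (φ x) (φ y) := by positivity
  nlinarith

/-! ### Supercontractive symbols on compact spaces -/

/-- By Arzelà–Ascoli, the unit ball of `Lip₀(X)` is compact for the uniform norm, and a
supercontractive `φ` turns uniform convergence on this ball into Lipschitz convergence of the
compositions with `φ`. -/
theorem isCompactOperator_compositionOperator [CompactSpace X]
    (φ : X → X) (hφ : ∃ K, LipschitzWith K φ) (hφ₀ : φ x₀ = x₀) (hsc : IsSupercontractive φ) :
    IsCompactOperator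
      (LipZero.compositionOperator 𝕜 φ hφ hφ₀ : LipZero 𝕜 X x₀ →L[𝕜] LipZero 𝕜 X x₀) := by
  let A : Set (BoundedContinuousFunction X 𝕜) := {f | LipschitzWith 1 f ∧ f x₀ = 0}
  have hev (x : X) : Continuous fun f : BoundedContinuousFunction X 𝕜 => f x :=
    continuous_eval_const x
  have hA : IsCompact A := by
    refine BoundedContinuousFunction.arzela_ascoli₂
      (Metric.closedBall 0 (Metric.diam (Set.univ : Set X))) (isCompact_closedBall _ _) A ?_ ?_ ?_
    · simp only [A, lipschitzWith_iff_dist_le_mul, Set.ofPred_and, Set.ofPred_forall]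
      refine IsClosed.inter (isClosed_iInter fun x => isClosed_iInter fun y => ?_) ?_
      · exact isClosed_le ((hev x).dist (hev y)) continuous_const
      · exact isClosed_eq (hev x₀) continuous_const
    · intro f x hf
      have := hf.1.dist_le_mul x x₀
      rw [hf.2, NNReal.coe_one, one_mul] at this
      exact this.trans (Metric.dist_le_diam_of_mem isCompact_univ.isBounded trivial trivial)
    · exact (LipschitzWith.uniformEquicontinuous _ 1 fun f => f.2.1).equicontinuous
  let T : A → LipZero 𝕜 X x₀ := fun f =>
    LipZero.compositionOperator 𝕜 φ hφ hφ₀ ⟨f.1, ⟨1, f.2.1⟩, f.2.2⟩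
  have hTsub (f g : A) (x y : X) : (T g - T f) x - (T g - T f) y =
      (g.1 (φ x) - f.1 (φ x)) - (g.1 (φ y) - f.1 (φ y)) := rfl
  have hT : Continuous T := by
    refine Metric.continuous_iff.2 fun f ε hε => ?_
    obtain ⟨δ, hδ, H⟩ := isSupercontractive_iff.1 hsc (ε / 4) (by positivity)
    refine ⟨ε * δ / 4, by positivity, fun g hg => ?_⟩
    rw [dist_eq_norm]
    refine (LipZero.norm_le_of_forall _ (half_pos hε).le fun x y => ?_).trans_lt (half_lt_self hε)
    rw [hTsub]
    rcases lt_or_ge (dist x y) δ with hxy | hxy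
    · have h1 := f.2.1.dist_le_mul (φ x) (φ y)
      have h2 := g.2.1.dist_le_mul (φ x) (φ y)
      rw [dist_eq_norm, NNReal.coe_one, one_mul] at h1 h2
      have h3 := H x y hxy
      calc _ = ‖(g.1 (φ x) - g.1 (φ y)) - (f.1 (φ x) - f.1 (φ y))‖ := by congr 1; ring
        _ ≤ dist (φ x) (φ y) + dist (φ x) (φ y) := (norm_sub_le _ _).trans (add_le_add h2 h1)
        _ ≤ ε / 2 * dist x y := by linarith
    · have h1 (z : X) : ‖g.1 z - f.1 z‖ ≤ ε * δ / 4 := by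
        rw [← dist_eq_norm]
        exact (BoundedContinuousFunction.dist_coe_le_dist z).trans hg.le
      refine (norm_sub_le _ _).trans ((add_le_add (h1 _) (h1 _)).trans ?_)
      nlinarith
  have := isCompact_iff_compactSpace.1 hA
  refine ⟨Set.range T, isCompact_range hT, ?_⟩
  refine Filter.mem_of_superset (Metric.closedBall_mem_nhds 0 one_pos) fun f hf => ?_
  rw [mem_closedBall_zero_iff] at hf
  have hf1 : LipschitzWith 1 f := LipschitzWith.of_dist_le_mul fun x y => by
    rw [dist_eq_norm]
    refine (LipZero.norm_sub_le f x y).trans ?_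
    rw [NNReal.coe_one]
    gcongr
  exact ⟨⟨BoundedContinuousFunction.mkOfCompact ⟨f, hf1.continuous⟩, hf1, f.map_base⟩, rfl⟩

end LittleLip

theorem mainTheorem2 {𝕜 : Type*} [RCLike 𝕜] {X : Type*} [MetricSpace X] [CompactSpace X] (x₀ : X)
    (hsep : LipSeparatesPointsUniformly 𝕜 X x₀)
    (φ : X → X) (hφ : ∃ K, LipschitzWith K φ) (hφ₀ : φ x₀ = x₀)
    (hw : IsWeaklyCompactOperator
      (LipZero.compositionOperator 𝕜 φ hφ hφ₀ : LipZero 𝕜 X x₀ →L[𝕜] LipZero 𝕜 X x₀)) :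
    IsCompactOperator
      (LipZero.compositionOperator 𝕜 φ hφ hφ₀ : LipZero 𝕜 X x₀ →L[𝕜] LipZero 𝕜 X x₀) :=
  isCompactOperator_compositionOperator φ hφ hφ₀
    (isSupercontractive_of_isWeaklyCompactOperator hsep φ hφ hφ₀ hw)
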